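/- **Setting.** A Bayesian game has $M$ players, each with the actions $\{1,\dots,N\}$; a distribution $p$ over a state space $\mathcal X$; for each state $x$ a distribution $r(x)$ over reward tensors $\theta\in\Theta$; for each player $i$ a signal function $\psi_i:\mathcal X\to\Psi_i$ with $\Psi_i$ finite; and utilities $u_i(a,\theta)\in[0,1]$ for action profiles $a$. Signals and rewards may be arbitrarily correlated. Let $S=\max_i|\Psi_i|$. A policy of player $i$ is a map $\pi_i:\Psi_i\to\{1,\dots,N\}$. For a policy profile $\pi$ let $U_i(\pi)=\mathbb E_{x\sim p,\,\theta\sim r(x)}\big[u_i\big((\pi_j(\psi_j(x)))_j,\theta\big)\big]$. For a swap function $f:\{1,\dots,N\}\times\Psi_i\to\{1,\dots,N\}$ let $U_i^f(\pi)$ be the same quantity with $\pi_i$ replaced by the policy $s\mapsto f(\pi_i(s),s)$. A distribution $D$ over policy profiles is an $\epsilon$-Bayes correlated equilibrium if $\mathbb E_{\pi\sim D}[U_i(\pi)]\ge\mathbb E_{\pi\sim D}[U_i^f(\pi)]-\epsilon$ for all $i$ and $f$; the average regret of player $i$ for $D$ is $\max_f\mathbb E_{\pi\sim D}[U_i^f(\pi)-U_i(\pi)]$.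 **Algorithm.** Let $\mathcal B$ be a bandit algorithm with $N$ actions, possibly tuned to the number of rounds: in each round it draws an action from a distribution that depends (measurably) on its past actions and observed rewards. Against an adaptive adversary, which chooses the reward vector $b^t\in[0,1]^N$ knowing the past of the play and the action distribution to which the algorithm commits in round $t$, the average swap regret of $\mathcal B$ over $T$ rounds is $\frac1T\big(\max_{f:[N]\to[N]}\sum_{t\le T} b^t_{f(a^t)}-\sum_{t\le T} b^t_{a^t}\big)$. Let $B(\epsilon)$ be the least number $T_0$ (or $\infty$) such that for every $T\ge T_0$ and every adaptive adversary the expected average swap regret after $T$ rounds is at most $\epsilon$, and let $$B(\epsilon,N)=\max\Big\{B(\epsilon),\ \Big\lceil\tfrac{2\,(N\log N+\log(2/\epsilon))}{\epsilon^2}\Big\rceil\Big\},$$ where a negative number is rounded up to $0$. In the parallel bandit algorithm $\mathcal B_S$, each player $i$ runs one independent copy of $\mathcal B$ for each signal in $\Psi_i$. In each round every copy draws an action, which gives a policy $\pi_i^t$; a state $x^t\sim p$ and a tensor $\theta^t\sim r(x^t)$ are drawn, independently of the past and of the policies; player $i$ plays $\pi_i^t(\psi_i(x^t))$; the copy for the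 observed signal $\psi_i(x^t)$ records the utility received, and the other copies record the reward $0$. **Theorem.** Let $\epsilon>0$, and suppose that all players of a Bayesian game use $\mathcal B_S$ for $T\ge B\big(\tfrac{\epsilon}{4S},N\big)$ rounds, $T\ge1$. Then the empirical distribution of the policy profiles $\pi^1,\dots,\pi^T$ is an $\epsilon$-Bayes correlated equilibrium in expectation over the states, the reward tensors and the randomness of $\mathcal B$: for each player the expectation of the average regret for the empirical distribution is at most $\epsilon$; and the expected empirical distribution is an $\epsilon$-Bayes correlated equilibrium. -/

import Mathlib

open MeasureTheory ProbabilityTheory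

noncomputable section

/-- A bandit algorithm with `N` actions. In round `t` (rounds are numbered from `0`) it commits to a
distribution over actions that depends on its own past actions and on the rewards observed for them;
`prob t h a` is the probability of drawing the action `a` after the history `h`. -/
structure BanditAlgorithm (N : ℕ) where
  prob : (t : ℕ) → (Fin t → Fin N × ℝ) → Fin N → ℝ
  prob_nonneg : ∀ t h a, 0 ≤ prob t h a
  prob_sum : ∀ t h, ∑ a, prob t h a = 1
  measurable_prob : ∀ t a, Measurable fun h => prob t h a

/-- The first `t` entries of a sequence of length `T`. -/
def past {α : Type*} {T : ℕ} (v : Fin T → α) (t : Fin T) : Fin t → α :=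
  fun k => v (k.castLE t.isLt.le)

/-- The product, over the rounds, of the probabilities with which the algorithm draws the actions
`a 0, a 1, …`, when the reward it records in round `t` is `r t`. -/
def BanditAlgorithm.pathProb {N : ℕ} (B : BanditAlgorithm N) {T : ℕ}
    (a : Fin T → Fin N) (r : Fin T → ℝ) : ℝ :=
  ∏ t : Fin T, B.prob t (past (fun k => (a k, r k)) t) (a t)

/-- An adaptive adversary: it chooses the reward vector of round `t`, with entries in `[0, 1]`,
knowing the actions of the earlier rounds. (Against a given algorithm, the earlier reward vectors and
the action distribution to which the algorithm commits in round `t` are functions of these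
actions.) -/
structure AdaptiveAdversary (N : ℕ) where
  reward : (t : ℕ) → (Fin t → Fin N) → Fin N → ℝ
  reward_mem : ∀ t h a, reward t h a ∈ Set.Icc (0 : ℝ) 1

/-- The reward vectors that are chosen along the action sequence `a`. -/
def AdaptiveAdversary.rewardSeq {N : ℕ} (Adv : AdaptiveAdversary N) {T : ℕ} (a : Fin T → Fin N) :
    Fin T → Fin N → ℝ :=
  fun t => Adv.reward t (past a t)

/-- Swap regret of the actions `a` on the reward vectors `b`: the maximum over all swap functions
`f`. -/
def swapRegret {N T : ℕ} (a : Fin T → Fin N) (b : Fin T → Fin N → ℝ) : ℝ :=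
  (⨆ f : Fin N → Fin N, ∑ t, b t (f (a t))) - ∑ t, b t (a t)

/-- Expected average swap regret of `B`, used for `T` rounds against the adversary `Adv`. -/
def expectedAverageSwapRegret {N : ℕ} (B : BanditAlgorithm N) (Adv : AdaptiveAdversary N) (T : ℕ) :
    ℝ :=
  ∑ a : Fin T → Fin N,
    B.pathProb a (fun t => Adv.rewardSeq a t (a t)) * (swapRegret a (Adv.rewardSeq a) / T)

/-- The runtime `B(ε)`: the least number of rounds from which on the expected average swap regret is
at most `ε` against every adaptive adversary (`⊤` if there is no such number). The algorithm may be
tuned to the number of rounds: `B T` is the version that is used for `T` rounds. -/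
def runtime {N : ℕ} (B : ℕ → BanditAlgorithm N) (ε : ℝ) : ℕ∞ :=
  sInf ((fun T₀ : ℕ => (T₀ : ℕ∞)) '' {T₀ : ℕ | ∀ T : ℕ, T₀ ≤ T →
    ∀ Adv : AdaptiveAdversary N, expectedAverageSwapRegret (B T) Adv T ≤ ε})

/-- The extended runtime `B(ε, N)`: at least `B(ε)`, and long enough for the concentration bound
over all `N ^ N` swap functions, that is, at least `2 (N log N + log (2 / ε)) / ε ^ 2`. -/
def extendedRuntime {N : ℕ} (B : ℕ → BanditAlgorithm N) (ε : ℝ) : ℕ∞ :=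
  max (runtime B ε)
    ((⌈2 * (N * Real.log N + Real.log (2 / ε)) / ε ^ 2⌉₊ : ℕ) : ℕ∞)

/-- A Bayesian game with `M` players, `N` actions for each player, finite signal sets `Ψ i`, states
in `X` and reward tensors in `Θ`. Signals and rewards may be arbitrarily correlated. -/
structure BayesianGame (M N : ℕ) (Ψ : Fin M → Type*) (X Θ : Type*)
    [MeasurableSpace X] [MeasurableSpace Θ] where
  /-- the signal of player `i` in a state -/
  signal : (i : Fin M) → X → Ψ i
  measurable_signal : ∀ i s, MeasurableSet {x | signal i x = s}
  /-- the distribution over states -/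
  stateDist : Measure X
  isProb : IsProbabilityMeasure stateDist
  /-- the distribution over reward tensors in each state -/
  tensorDist : Kernel X Θ
  isMarkov : IsMarkovKernel tensorDist
  /-- the utility of player `i` under an action profile and a reward tensor -/
  utility : Fin M → (Fin M → Fin N) → Θ → ℝ
  measurable_utility : ∀ i a, Measurable (utility i a)
  utility_mem : ∀ i a θ, utility i a θ ∈ Set.Icc (0 : ℝ) 1

attribute [instance] BayesianGame.isProb BayesianGame.isMarkov

/-- Policy profiles: each player has a policy, which maps signals to actions. -/
abbrev PolicyProfile {M : ℕ} (N : ℕ) (Ψ : Fin M → Type*) : Type _ :=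
  (i : Fin M) → Ψ i → Fin N

/-- `S`, the maximum over the players of the number of signals. -/
def maxSignals {M : ℕ} (Ψ : Fin M → Type*) [∀ i, Fintype (Ψ i)] : ℕ :=
  Finset.univ.sup fun i => Fintype.card (Ψ i)

/-- The profile in which player `i` applies the swap function `f` to the recommended action and the
signal, and all others follow `π`. -/
def deviate {M N : ℕ} {Ψ : Fin M → Type*} (i : Fin M) (f : Fin N → Ψ i → Fin N)
    (π : PolicyProfile N Ψ) : PolicyProfile N Ψ :=
  Function.update π i fun s => f (π i s) s

namespace BayesianGame

variable {M N : ℕ} {Ψ : Fin M → Type*} {X Θ : Type*} [MeasurableSpace X] [MeasurableSpace Θ]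

/-- The joint law of the state and the reward tensor in one round. -/
def law (G : BayesianGame M N Ψ X Θ) : Measure (X × Θ) :=
  G.stateDist ⊗ₘ G.tensorDist

/-- The utility of player `i` when `π` is played and `w` consists of the state and the reward
tensor. -/
def payoff (G : BayesianGame M N Ψ X Θ) (i : Fin M) (π : PolicyProfile N Ψ) (w : X × Θ) : ℝ :=
  G.utility i (fun j => π j (G.signal j w.1)) w.2

/-- The expected utility of player `i` when `π` is played. -/
def expectedPayoff (G : BayesianGame M N Ψ X Θ) (i : Fin M) (π : PolicyProfile N Ψ) : ℝ :=
  ∫ w, G.payoff i π w ∂G.law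

variable [∀ i, Fintype (Ψ i)] [∀ i, DecidableEq (Ψ i)]

/-- The expected utility of player `i` when all players follow the recommendation `π ∼ D`. -/
def followValue (G : BayesianGame M N Ψ X Θ) (D : PolicyProfile N Ψ → ℝ) (i : Fin M) : ℝ :=
  ∑ π, D π * G.expectedPayoff i π

/-- The expected utility of player `i` when `π ∼ D` is recommended and player `i` deviates with the
swap function `f`. -/
def deviationValue (G : BayesianGame M N Ψ X Θ) (D : PolicyProfile N Ψ → ℝ) (i : Fin M)
    (f : Fin N → Ψ i → Fin N) : ℝ :=
  ∑ π, D π * G.expectedPayoff i (deviate i f π)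

/-- `D` is a distribution over policy profiles and an `ε`-Bayes correlated equilibrium. -/
def IsApproxBCE (G : BayesianGame M N Ψ X Θ) (ε : ℝ) (D : PolicyProfile N Ψ → ℝ) : Prop :=
  D ∈ stdSimplex ℝ (PolicyProfile N Ψ) ∧
    ∀ (i : Fin M) (f : Fin N → Ψ i → Fin N), G.deviationValue D i f - ε ≤ G.followValue D i

/-- The average regret of player `i` for `D`: the smallest `ε` for which no swap function gains
player `i` more than `ε`. -/
def averageRegret (G : BayesianGame M N Ψ X Θ) (D : PolicyProfile N Ψ → ℝ) (i : Fin M) : ℝ :=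
  ⨆ f : Fin N → Ψ i → Fin N, (G.deviationValue D i f - G.followValue D i)

/-- The reward that the copy of player `i` for the signal `s` records: the player's utility if `s` is
the observed signal, and `0` otherwise. -/
def recordedReward (G : BayesianGame M N Ψ X Θ) (i : Fin M) (s : Ψ i) (π : PolicyProfile N Ψ)
    (w : X × Θ) : ℝ :=
  if G.signal i w.1 = s then G.payoff i π w else 0

/-- Every player `i` runs one copy of `B` for each of the signals in `Ψ i`; all copies draw their
actions independently given the past. Given the states and reward tensors `w t` of all rounds, this
is the probability that the players use the policy profiles `π 0, π 1, …`. -/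
def playProb (G : BayesianGame M N Ψ X Θ) (B : BanditAlgorithm N) {T : ℕ}
    (w : Fin T → X × Θ) (π : Fin T → PolicyProfile N Ψ) : ℝ :=
  ∏ i, ∏ s, B.pathProb (fun t => π t i s) (fun t => G.recordedReward i s (π t) (w t))

/-- The expectation of `F`, a function of the policy profiles used in `T` rounds of play with the
parallel bandit algorithm, over the states and reward tensors (drawn independently in each round)
and over the randomness of all the copies of `B`. -/
def playExpectation (G : BayesianGame M N Ψ X Θ) (B : BanditAlgorithm N) (T : ℕ)
    (F : (Fin T → PolicyProfile N Ψ) → ℝ) : ℝ :=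
  ∫ w, ∑ π, G.playProb B w π * F π ∂(Measure.pi fun _ : Fin T => G.law)

end BayesianGame

/-- The empirical distribution (uniform distribution over the rounds) of a sequence of policy
profiles. -/
def empirical {M N T : ℕ} {Ψ : Fin M → Type*} [∀ i, Fintype (Ψ i)] [∀ i, DecidableEq (Ψ i)]
    (π : Fin T → PolicyProfile N Ψ) : PolicyProfile N Ψ → ℝ :=
  fun ρ => ((Finset.univ.filter fun t => π t = ρ).card : ℝ) / T

end

/-! Player `i`'s gain from a deviation splits over the signals (`expectedPayoff_deviate_sub`): on
the signal `s` it is the mean of `swapGain`, the gain that the copy for `s` would make from the swap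
function `f(·, s)`. The mean is the realised gain plus a fluctuation, and the two parts are bounded
separately.

Realised gains. Fix all states and tensors. The other copies then form a randomised opponent of the
copy `(i, s)`. Some deterministic strategy does at least as much damage (`exists_strategy_sum_le`),
and such a strategy is an adaptive adversary. So the runtime assumption bounds the copy's expected
average swap regret by `δ` for every fixed realisation (`sum_playProb_mul_swapRegret_le`).
Unobserved signals do no harm: there the reward vector is zero.

Fluctuations. The policies of a round depend only on the past, so the fresh state and tensor make
mean gain minus realised gain a martingale difference. Hoeffding's lemma in each round bounds the
exponential moment by `exp (T * l ^ 2 / 2)` (`IsActionKernel.integral_sum_prod_mul_le`). A soft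
maximum over the `N ^ N` swap functions turns this into a bound on the expected maximum, with no
tail estimate.

With `l = δ` each part costs at most `δ` per signal on average. For `δ = ε / (4 S)` and `ε < 1` the
total is at most `2 S δ = ε / 2`; for `ε ≥ 1` the claim is trivial. The statement on the expected
empirical distribution follows by linearity. -/

/-! ### Adaptive processes and derandomisation of the opponent. -/

theorem sum_fin_succ_pi {α β : Type*} [Fintype α] [AddCommMonoid β] {T : ℕ}
    (F : (Fin (T + 1) → α) → β) :
    ∑ v, F v = ∑ v : Fin T → α, ∑ x, F (Fin.snoc v x) := by
  rw [← Fintype.sum_equiv (Fin.snocEquiv fun _ : Fin (T + 1) => α)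
    (fun y => F (Fin.snoc y.2 y.1)) F (fun y => rfl), Fintype.sum_prod_type_right]

theorem past_snoc_castSucc {α : Type*} {T : ℕ} (v : Fin T → α) (x : α) (t : Fin T) :
    past (Fin.snoc v x : Fin (T + 1) → α) t.castSucc = past v t := by
  funext k
  exact Fin.snoc_castSucc (α := fun _ => α) x v (k.castLE t.isLt.le)

theorem past_snoc_last {α : Type*} {T : ℕ} (v : Fin T → α) (x : α) :
    past (Fin.snoc v x : Fin (T + 1) → α) (Fin.last T) = v := by
  funext k
  exact Fin.snoc_castSucc (α := fun _ => α) x v k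

/-- Path probabilities factor over the last round. -/
theorem prod_past_snoc {α : Type*} {T : ℕ} (q : (t : ℕ) → (Fin t → α) → α → ℝ)
    (v : Fin T → α) (x : α) :
    ∏ t : Fin (T + 1), q (t : ℕ) (past (Fin.snoc v x : Fin (T + 1) → α) t)
        (Fin.snoc (α := fun _ => α) v x t) =
      (∏ t : Fin T, q (t : ℕ) (past v t) (v t)) * q T v x := by
  rw [Fin.prod_univ_castSucc]
  congr 1
  · refine Finset.prod_congr rfl fun t _ => ?_
    rw [past_snoc_castSucc, Fin.snoc_castSucc]
    rfl
  · rw [past_snoc_last, Fin.snoc_last]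
    rfl

theorem sum_prod_past_eq_one {α : Type*} [Fintype α] {T : ℕ}
    (q : (t : ℕ) → (Fin t → α) → α → ℝ) (hq : ∀ t h, ∑ x, q t h x = 1) :
    ∑ v : Fin T → α, ∏ t : Fin T, q (t : ℕ) (past v t) (v t) = 1 := by
  induction T with
  | zero => simp
  | succ T ih =>
    rw [sum_fin_succ_pi]
    simp_rw [prod_past_snoc, ← Finset.mul_sum, hq, mul_one]
    exact ih

/-- A random opponent of an adaptive process can be replaced by a deterministic strategy that
knows the past of the process, without decreasing the expectation of `Φ`. -/
theorem exists_strategy_sum_le {A O : Type*} [Fintype A] [Fintype O] [Nonempty O] {T : ℕ}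
    (p : (t : ℕ) → (Fin t → A × O) → A → ℝ) (q : (t : ℕ) → (Fin t → A × O) → O → ℝ)
    (hp : ∀ t h a, 0 ≤ p t h a) (hq : ∀ t h o, 0 ≤ q t h o) (hq1 : ∀ t h, ∑ o, q t h o = 1)
    (Φ : (Fin T → A × O) → ℝ) :
    ∃ σ : (t : ℕ) → (Fin t → A) → O,
      ∑ h : Fin T → A × O, (∏ t : Fin T, p (t : ℕ) (past h t) (h t).1 * q (t : ℕ) (past h t) (h t).2) * Φ h ≤
        ∑ a : Fin T → A, (∏ t : Fin T, p (t : ℕ) (past (fun k => (a k, σ k (past a k))) t) (a t)) *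
          Φ (fun k => (a k, σ k (past a k))) := by
  induction T with
  | zero =>
    refine ⟨fun _ _ => Classical.arbitrary O, ?_⟩
    simp [Subsingleton.elim _ (default : Fin 0 → A × O)]
  | succ T ih =>
    -- Backward induction: the opponent's best reply in the last round, given the history, dominates
    -- every mixture of replies.
    have best : ∀ h : Fin T → A × O, ∃ o : O, ∀ o' : O,
        ∑ a, p T h a * Φ (Fin.snoc h (a, o')) ≤ ∑ a, p T h a * Φ (Fin.snoc h (a, o)) := fun h =>
      Finite.exists_max fun o => ∑ a, p T h a * Φ (Fin.snoc h (a, o))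
    choose o ho using best
    obtain ⟨σ, hσ⟩ := ih fun h => ∑ a, p T h a * Φ (Fin.snoc h (a, o h))
    -- The strategy sees only the process's own actions; its earlier replies are reconstructed from
    -- `σ`.
    let τ : (t : ℕ) → (Fin t → A) → O :=
      Function.update σ T fun a => o fun k => (a k, σ k (past a k))
    have hτ : ∀ t : Fin T, τ t = σ t := fun t =>
      Function.update_of_ne t.isLt.ne _ _
    have hτT : τ T = fun a => o fun k => (a k, σ k (past a k)) := Function.update_self ..
    have hpath : ∀ (a : Fin T → A) (x : A),
        (fun k : Fin (T + 1) => ((Fin.snoc a x : Fin (T + 1) → A) k,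
          τ k (past (Fin.snoc a x : Fin (T + 1) → A) k))) =
        Fin.snoc (α := fun _ => A × O) (fun k => (a k, σ k (past a k)))
          (x, o fun k => (a k, σ k (past a k))) := by
      intro a x
      funext k
      refine Fin.lastCases ?_ (fun k => ?_) k
      · rw [past_snoc_last, Fin.snoc_last, Fin.snoc_last]
        exact congrArg (Prod.mk x) (congrFun hτT a)
      · rw [past_snoc_castSucc, Fin.snoc_castSucc, Fin.snoc_castSucc]
        exact congrArg (Prod.mk (a k)) (congrFun (hτ k) (past a k))
    refine ⟨τ, ?_⟩
    rw [sum_fin_succ_pi, sum_fin_succ_pi]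
    have hw : ∀ (h : Fin T → A × O),
        0 ≤ ∏ t : Fin T, p (t : ℕ) (past h t) (h t).1 * q (t : ℕ) (past h t) (h t).2 := fun h =>
      Finset.prod_nonneg fun t _ => mul_nonneg (hp ..) (hq ..)
    have hl : ∀ h : Fin T → A × O,
        ∑ x, (∏ t : Fin (T + 1), p (t : ℕ) (past (Fin.snoc h x : Fin (T + 1) → A × O) t)
          (Fin.snoc (α := fun _ => A × O) h x t).1 *
          q (t : ℕ) (past (Fin.snoc h x : Fin (T + 1) → A × O) t)
          (Fin.snoc (α := fun _ => A × O) h x t).2) * Φ (Fin.snoc h x) ≤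
        (∏ t : Fin T, p (t : ℕ) (past h t) (h t).1 * q (t : ℕ) (past h t) (h t).2) *
          ∑ a, p T h a * Φ (Fin.snoc h (a, o h)) := by
      intro h
      have hs := fun x => prod_past_snoc (fun t h x => p t h x.1 * q t h x.2) h x
      simp_rw [hs, mul_assoc, ← Finset.mul_sum]
      refine mul_le_mul_of_nonneg_left ?_ (hw h)
      rw [Fintype.sum_prod_type_right]
      calc ∑ y, ∑ x, p T h x * (q T h y * Φ (Fin.snoc h (x, y)))
          = ∑ y, q T h y * ∑ x, p T h x * Φ (Fin.snoc h (x, y)) := by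
            simp_rw [Finset.mul_sum]
            exact Finset.sum_congr rfl fun y _ => Finset.sum_congr rfl fun x _ => by ring
        _ ≤ ∑ y, q T h y * ∑ a, p T h a * Φ (Fin.snoc h (a, o h)) :=
            Finset.sum_le_sum fun y _ => mul_le_mul_of_nonneg_left (ho h y) (hq ..)
        _ = _ := by rw [← Finset.sum_mul, hq1, one_mul]
    refine (Finset.sum_le_sum fun h _ => hl h).trans (hσ.trans (Finset.sum_le_sum fun a _ => ?_))
    rw [Finset.mul_sum]
    refine Finset.sum_le_sum fun x _ => ?_
    rw [hpath]
    have hs := prod_past_snoc (fun t h x => p t h x.1) (fun k => (a k, σ k (past a k)))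
      (x, o fun k => (a k, σ k (past a k)))
    simp only [← hpath a x] at hs
    simp only [← hpath a x]
    rw [hs, mul_assoc]

theorem BanditAlgorithm.pos {N : ℕ} (B : BanditAlgorithm N) : 0 < N := by
  rcases Nat.eq_zero_or_pos N with rfl | h
  · simpa using B.prob_sum 0 default
  · exact h

theorem sum_prod_prob_eq_one {ι κ : Type*} [Fintype ι] [DecidableEq ι] [Fintype κ]
    (f : ι → κ → ℝ) (hf : ∀ i, ∑ x, f i x = 1) : ∑ v : ι → κ, ∏ i, f i (v i) = 1 := by
  classical
  have h := Finset.prod_univ_sum (fun _ : ι => (Finset.univ : Finset κ)) f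
  rw [Fintype.piFinset_univ] at h
  rw [← h]
  simp [hf]

/-- A runtime bounded by a natural number is not the infimum of the empty set, so it is attained by
an admissible threshold. -/
theorem expectedAverageSwapRegret_le_of_runtime_le {N T : ℕ} {B : ℕ → BanditAlgorithm N} {δ : ℝ}
    (h : runtime B δ ≤ (T : ℕ∞)) (Adv : AdaptiveAdversary N) :
    expectedAverageSwapRegret (B T) Adv T ≤ δ := by
  have hne : ((fun T₀ : ℕ => (T₀ : ℕ∞)) '' {T₀ : ℕ | ∀ T : ℕ, T₀ ≤ T →
      ∀ Adv : AdaptiveAdversary N, expectedAverageSwapRegret (B T) Adv T ≤ δ}).Nonempty := by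
    by_contra hemp
    rw [Set.not_nonempty_iff_eq_empty] at hemp
    rw [runtime, hemp, sInf_empty, top_le_iff] at h
    exact ENat.natCast_ne_top T h
  obtain ⟨T₀, hT₀, hinf⟩ := csInf_mem hne
  refine hT₀ T ?_ Adv
  rw [runtime, ← hinf] at h
  exact ENat.natCast_le_natCast.1 h

/-! ### Isolating one copy of the bandit algorithm. -/

/-- The profile in which player `i` plays the action `a` on the signal `s` and which agrees with `π`
otherwise. -/
def setAction {M N : ℕ} {Ψ : Fin M → Type*} [∀ i, DecidableEq (Ψ i)] (i : Fin M) (s : Ψ i)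
    (a : Fin N) (π : PolicyProfile N Ψ) : PolicyProfile N Ψ :=
  Function.update π i (Function.update (π i) s a)

/-- Splitting off the action that player `i` plays on the signal `s`. -/
def splitAction {M : ℕ} (N : ℕ) {Ψ : Fin M → Type*} [∀ i, DecidableEq (Ψ i)] (i : Fin M)
    (s : Ψ i) :
    PolicyProfile N Ψ ≃ Fin N × ({c : (Σ j, Ψ j) // c ≠ ⟨i, s⟩} → Fin N) :=
  (Equiv.piCurry fun (j : Fin M) (_ : Ψ j) => Fin N).symm.trans
    (Equiv.piSplitAt (⟨i, s⟩ : Σ j, Ψ j) fun _ => Fin N)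

section splitAction

variable {M N : ℕ} {Ψ : Fin M → Type*} [∀ i, DecidableEq (Ψ i)] {i : Fin M} {s : Ψ i}
  (y : Fin N × ({c : (Σ j, Ψ j) // c ≠ ⟨i, s⟩} → Fin N))

theorem splitAction_symm_self : (splitAction N i s).symm y i s = y.1 :=
  congrArg Prod.fst ((splitAction N i s).apply_symm_apply y)

theorem splitAction_symm_of_ne (c : {c : (Σ j, Ψ j) // c ≠ ⟨i, s⟩}) :
    (splitAction N i s).symm y c.1.1 c.1.2 = y.2 c :=
  congrFun (congrArg Prod.snd ((splitAction N i s).apply_symm_apply y)) c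

theorem splitAction_symm_of_player_ne {j : Fin M} (hj : j ≠ i) (s' : Ψ j) :
    (splitAction N i s).symm y j s' = y.2 ⟨⟨j, s'⟩, fun h => hj (congrArg Sigma.fst h)⟩ :=
  splitAction_symm_of_ne y ⟨⟨j, s'⟩, fun h => hj (congrArg Sigma.fst h)⟩

end splitAction

namespace BayesianGame

variable {M N : ℕ} {Ψ : Fin M → Type*} {X Θ : Type*} [MeasurableSpace X] [MeasurableSpace Θ]
  (G : BayesianGame M N Ψ X Θ)

instance : IsProbabilityMeasure G.law := by
  unfold law; infer_instance

theorem payoff_mem (i : Fin M) (π : PolicyProfile N Ψ) (w : X × Θ) :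
    G.payoff i π w ∈ Set.Icc (0 : ℝ) 1 :=
  G.utility_mem _ _ _

theorem measurable_payoff [∀ i, Fintype (Ψ i)] (i : Fin M) (π : PolicyProfile N Ψ) :
    Measurable (G.payoff i π) := by
  have hact : Measurable fun w : X × Θ => fun j => π j (G.signal j w.1) := by
    refine measurable_pi_lambda _ fun j => measurable_to_countable' fun a => ?_
    have : (fun w : X × Θ => π j (G.signal j w.1)) ⁻¹' {a} =
        Prod.fst ⁻¹' ⋃ s ∈ {s : Ψ j | π j s = a}, {x | G.signal j x = s} := by
      ext w; simp
    rw [this]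
    exact measurable_fst (MeasurableSet.biUnion (Set.to_countable _) fun s _ =>
      G.measurable_signal j s)
  have hu : Measurable fun z : (Fin M → Fin N) × Θ => G.utility i z.1 z.2 :=
    measurable_from_prod_countable_right fun a => G.measurable_utility i a
  exact hu.comp (hact.prodMk measurable_snd)

variable [∀ i, DecidableEq (Ψ i)]

theorem recordedReward_mem (i : Fin M) (s : Ψ i) (π : PolicyProfile N Ψ) (w : X × Θ) :
    G.recordedReward i s π w ∈ Set.Icc (0 : ℝ) 1 := by
  unfold recordedReward
  split_ifs
  · exact G.payoff_mem i π w
  · simp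

/-- If `s` is not observed, both sides are `0`; if it is, player `i`'s actions on other signals do
not matter. -/
theorem recordedReward_congr {i : Fin M} {s : Ψ i} {π π' : PolicyProfile N Ψ}
    (h : π i s = π' i s) (h' : ∀ j, j ≠ i → π j = π' j) (w : X × Θ) :
    G.recordedReward i s π w = G.recordedReward i s π' w := by
  unfold recordedReward
  split_ifs with hs
  · unfold payoff
    congr 1
    funext j
    by_cases hj : j = i
    · subst hj
      rw [hs, h]
    · rw [h' j hj]
  · rfl

theorem measurable_recordedReward [∀ i, Fintype (Ψ i)] (i : Fin M) (s : Ψ i)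
    (π : PolicyProfile N Ψ) : Measurable (G.recordedReward i s π) :=
  Measurable.ite (measurable_fst (G.measurable_signal i s)) (G.measurable_payoff i π)
    measurable_const

theorem sum_recordedReward [∀ i, Fintype (Ψ i)] (i : Fin M) (π : PolicyProfile N Ψ) (w : X × Θ) :
    ∑ s, G.recordedReward i s π w = G.payoff i π w := by
  simp [recordedReward]

/-- The reward vector against which the copy of player `i` for the signal `s` plays. -/
def copyReward (i : Fin M) (s : Ψ i) (π : PolicyProfile N Ψ) (w : X × Θ) (a : Fin N) : ℝ :=
  G.recordedReward i s (setAction i s a π) w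

theorem copyReward_eq {i : Fin M} {s : Ψ i} {π π' : PolicyProfile N Ψ} {a : Fin N}
    (h : π' i s = a) (h' : ∀ j, j ≠ i → π' j = π j) (w : X × Θ) :
    G.copyReward i s π w a = G.recordedReward i s π' w := by
  refine G.recordedReward_congr ?_ (fun j hj => ?_) w
  · simp [setAction, h]
  · simp [setAction, hj, h' j hj]

variable [∀ i, Fintype (Ψ i)]

/-- Regrouping by rounds exhibits play as one adaptive process in which all copies draw
independently given the past. -/
theorem playProb_eq_prod (B : BanditAlgorithm N) {T : ℕ} (w : Fin T → X × Θ)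
    (π : Fin T → PolicyProfile N Ψ) :
    G.playProb B w π = ∏ t : Fin T, ∏ c : Σ i, Ψ i,
      B.prob t (past (fun k => (π k c.1 c.2, G.recordedReward c.1 c.2 (π k) (w k))) t)
        (π t c.1 c.2) := by
  rw [Finset.prod_comm, Fintype.prod_sigma]
  rfl

/-- With the realisation `w` fixed, everything outside the copy `(i, s)` is its opponent `O`, whose
random play is replaced by a deterministic strategy. No averaging over `w` is involved. The sequence
`w` is indexed by all of `ℕ` because an adversary must specify a reward for every round. -/
theorem sum_playProb_mul_swapRegret_le (B : BanditAlgorithm N) {T : ℕ} {δ : ℝ}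
    (hB : ∀ Adv : AdaptiveAdversary N, expectedAverageSwapRegret B Adv T ≤ δ)
    (w : ℕ → X × Θ) (i : Fin M) (s : Ψ i) :
    ∑ π : Fin T → PolicyProfile N Ψ, G.playProb B (fun t => w t) π *
      (swapRegret (fun t => π t i s) (fun t => G.copyReward i s (π t) (w t)) / T) ≤ δ := by
  have : Nonempty (Fin N) := ⟨⟨0, B.pos⟩⟩
  let O := {c : (Σ j, Ψ j) // c ≠ ⟨i, s⟩} → Fin N
  let e : PolicyProfile N Ψ ≃ Fin N × O := splitAction N i s
  let p : (t : ℕ) → (Fin t → Fin N × O) → Fin N → ℝ := fun t h a =>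
    B.prob t (fun k => ((h k).1, G.recordedReward i s (e.symm (h k)) (w k))) a
  let q : (t : ℕ) → (Fin t → Fin N × O) → O → ℝ := fun t h o =>
    ∏ c, B.prob t (fun k => ((h k).2 c,
      G.recordedReward c.1.1 c.1.2 (e.symm (h k)) (w k))) (o c)
  let Φ : (Fin T → Fin N × O) → ℝ := fun h =>
    swapRegret (fun t => (h t).1)
      (fun t x => G.recordedReward i s (e.symm (x, (h t).2)) (w t)) / T
  obtain ⟨σ, hσ⟩ := exists_strategy_sum_le (T := T) p q (fun _ _ _ => B.prob_nonneg _ _ _)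
    (fun _ _ _ => Finset.prod_nonneg fun _ _ => B.prob_nonneg _ _ _)
    (fun t h => sum_prod_prob_eq_one (fun c => B.prob t (fun k => ((h k).2 c,
      G.recordedReward c.1.1 c.1.2 (e.symm (h k)) (w k)))) fun _ => B.prob_sum _ _) Φ
  let Adv : AdaptiveAdversary N :=
    { reward := fun t a x => G.recordedReward i s (e.symm (x, σ t a)) (w t)
      reward_mem := fun t a x => G.recordedReward_mem _ _ _ _ }
  refine le_trans (le_of_eq ?_) (hσ.trans (hB Adv))
  refine Fintype.sum_equiv (Equiv.arrowCongr (Equiv.refl (Fin T)) e) _ _ fun π => ?_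
  obtain ⟨h, rfl⟩ : ∃ h : Fin T → Fin N × O, π = fun t => e.symm (h t) :=
    ⟨fun t => e (π t), by simp⟩
  have hh : Equiv.arrowCongr (Equiv.refl (Fin T)) e (fun t => e.symm (h t)) = h := by
    funext t; simp
  have h1 : ∀ t, (e.symm (h t)) i s = (h t).1 := fun t => splitAction_symm_self _
  have h2 : ∀ t (c : {c : (Σ j, Ψ j) // c ≠ ⟨i, s⟩}), (e.symm (h t)) c.1.1 c.1.2 = (h t).2 c :=
    fun t c => splitAction_symm_of_ne _ c
  rw [hh]
  congr 1
  · rw [playProb_eq_prod]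
    refine Finset.prod_congr rfl fun t _ => ?_
    -- The factor of the copy `(i, s)` is `p`; the product over the other copies is `q`.
    rw [Fintype.prod_eq_mul_prod_subtype_ne _ (⟨i, s⟩ : Σ j, Ψ j)]
    simp only [h1, h2]
    rfl
  · have h3 : ∀ t, G.copyReward i s (e.symm (h t)) (w t) =
        fun x => G.recordedReward i s (e.symm (x, (h t).2)) (w t) := by
      intro t
      funext x
      refine G.copyReward_eq (π' := e.symm (x, (h t).2)) (splitAction_symm_self _)
        (fun j hj => ?_) _
      funext s'
      exact (splitAction_symm_of_player_ne _ hj s').trans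
        (splitAction_symm_of_player_ne (h t) hj s').symm
    simp only [h1, h3, Φ]

end BayesianGame

/-! ### Exponential moments along a process with independent signals. -/

theorem integral_pi_fin_succ {W : Type*} [MeasurableSpace W] (μ : Measure W)
    [IsProbabilityMeasure μ] {T : ℕ} {f : (Fin (T + 1) → W) → ℝ}
    (hf : Integrable f (Measure.pi fun _ => μ)) :
    ∫ w, f w ∂(Measure.pi fun _ => μ) =
      ∫ w : Fin T → W, ∫ x, f (Fin.snoc w x) ∂μ ∂(Measure.pi fun _ => μ) := by
  have hm := (measurePreserving_piFinSuccAbove (fun _ : Fin (T + 1) => μ) (Fin.last T)).symm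
  have hsymm : ∀ y : W × (Fin T → W),
      (MeasurableEquiv.piFinSuccAbove (fun _ : Fin (T + 1) => W) (Fin.last T)).symm y =
        Fin.snoc y.2 y.1 := fun y => Fin.insertNth_last' _ _
  rw [← hm.integral_comp' f, integral_prod_symm]
  · simp_rw [hsymm]
  · exact hm.integrable_comp_of_integrable hf

/-- A process with finitely many actions in which the action of round `t` depends on the past actions
and on the past signals. -/
structure IsActionKernel {P W : Type*} [Fintype P] [MeasurableSpace W]
    (K : (t : ℕ) → (Fin t → P × W) → P → ℝ) : Prop where
  nonneg : ∀ t h ρ, 0 ≤ K t h ρ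
  sum_eq_one : ∀ t h, ∑ ρ, K t h ρ = 1
  measurable : ∀ t (π : Fin t → P) ρ, Measurable fun w : Fin t → W => K t (fun k => (π k, w k)) ρ

namespace IsActionKernel

variable {P W : Type*} [Fintype P] [MeasurableSpace W] {K : (t : ℕ) → (Fin t → P × W) → P → ℝ}

theorem le_one (hK : IsActionKernel K) (t : ℕ) (h : Fin t → P × W) (ρ : P) : K t h ρ ≤ 1 := by
  rw [← hK.sum_eq_one t h]
  exact Finset.single_le_sum (fun ρ _ => hK.nonneg t h ρ) (Finset.mem_univ ρ)

theorem measurable_past (hK : IsActionKernel K) {T : ℕ} (π : Fin T → P) (t : Fin T) (ρ : P) :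
    Measurable fun w : Fin T → W => K t (past (fun k => (π k, w k)) t) ρ :=
  (hK.measurable t (past π t) ρ).comp (measurable_pi_lambda _ fun _ => measurable_pi_apply _)

theorem prod_nonneg (hK : IsActionKernel K) {T : ℕ} (π : Fin T → P) (w : Fin T → W) :
    0 ≤ ∏ t : Fin T, K t (past (fun k => (π k, w k)) t) (π t) :=
  Finset.prod_nonneg fun _ _ => hK.nonneg _ _ _

theorem prod_le_one (hK : IsActionKernel K) {T : ℕ} (π : Fin T → P) (w : Fin T → W) :
    ∏ t : Fin T, K t (past (fun k => (π k, w k)) t) (π t) ≤ 1 :=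
  Finset.prod_le_one (fun _ _ => hK.nonneg _ _ _) fun _ _ => hK.le_one _ _ _

theorem measurable_prod (hK : IsActionKernel K) {T : ℕ} (π : Fin T → P) :
    Measurable fun w : Fin T → W => ∏ t : Fin T, K t (past (fun k => (π k, w k)) t) (π t) :=
  Finset.measurable_fun_prod _ fun t _ => hK.measurable_past π t (π t)

theorem sum_prod_eq_one [Nonempty W] (hK : IsActionKernel K) {T : ℕ} (w : Fin T → W) :
    ∑ π : Fin T → P, ∏ t : Fin T, K t (past (fun k => (π k, w k)) t) (π t) = 1 := by
  -- The values beyond the horizon are irrelevant; they only make the kernel available at every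
  -- time.
  let v : ℕ → W := fun k => if h : k < T then w ⟨k, h⟩ else Classical.arbitrary W
  have hv : w = fun t : Fin T => v t := by
    funext t; simp [v]
  rw [hv]
  exact sum_prod_past_eq_one (fun t (h : Fin t → P) ρ => K t (fun k => (h k, v k)) ρ)
    fun t h => hK.sum_eq_one _ _

theorem integrable_prod_mul {μ : Measure W} [IsProbabilityMeasure μ] (hK : IsActionKernel K)
    {T : ℕ} (π : Fin T → P) {e : P → W → ℝ} {C₀ : ℝ} (he : ∀ ρ, Measurable (e ρ))
    (he0 : ∀ ρ w, 0 ≤ e ρ w) (hC₀ : ∀ ρ w, e ρ w ≤ C₀) :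
    Integrable (fun w => (∏ t : Fin T, K t (past (fun k => (π k, w k)) t) (π t)) *
      ∏ t, e (π t) (w t)) (Measure.pi fun _ => μ) := by
  refine Integrable.of_mem_Icc 0 (C₀ ^ T) ?_ (Filter.Eventually.of_forall fun w => ⟨?_, ?_⟩)
  · exact ((hK.measurable_prod π).mul (Finset.measurable_fun_prod _ fun t _ =>
      (he _).comp (measurable_pi_apply t))).aemeasurable
  · exact mul_nonneg (hK.prod_nonneg π w) (Finset.prod_nonneg fun _ _ => he0 _ _)
  · have h1 : ∏ t, e (π t) (w t) ≤ C₀ ^ T := by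
      simpa using Finset.prod_le_prod (s := Finset.univ) (fun t _ => he0 (π t) (w t))
        fun t _ => hC₀ (π t) (w t)
    exact (mul_le_of_le_one_left (Finset.prod_nonneg fun _ _ => he0 _ _)
      (hK.prod_le_one π w)).trans h1

/-- Factors whose conditional means are at most `C` multiply to a mean of at most `C ^ T`. -/
theorem integral_sum_prod_mul_le (μ : Measure W) [IsProbabilityMeasure μ] (hK : IsActionKernel K)
    (T : ℕ) {e : P → W → ℝ} {C₀ C : ℝ} (he : ∀ ρ, Measurable (e ρ))
    (he0 : ∀ ρ w, 0 ≤ e ρ w) (hC₀ : ∀ ρ w, e ρ w ≤ C₀) (hC0 : 0 ≤ C)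
    (hC : ∀ ρ, ∫ w, e ρ w ∂μ ≤ C) :
    ∫ w, ∑ π : Fin T → P, (∏ t : Fin T, K t (past (fun k => (π k, w k)) t) (π t)) *
      ∏ t, e (π t) (w t) ∂(Measure.pi fun _ => μ) ≤ C ^ T := by
  have hint : ∀ T : ℕ, Integrable (fun w => ∑ π : Fin T → P,
      (∏ t : Fin T, K t (past (fun k => (π k, w k)) t) (π t)) * ∏ t, e (π t) (w t))
      (Measure.pi fun _ => μ) := fun T =>
    integrable_finsetSum _ fun π _ => hK.integrable_prod_mul π he he0 hC₀
  have heint : ∀ ρ, Integrable (e ρ) μ := fun ρ =>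
    Integrable.of_mem_Icc 0 C₀ (he ρ).aemeasurable
      (Filter.Eventually.of_forall fun w => ⟨he0 ρ w, hC₀ ρ w⟩)
  induction T with
  | zero => simp
  | succ T ih =>
    have hpair : ∀ (π : Fin T → P) (ρ : P) (w : Fin T → W) (x : W),
        (fun k : Fin (T + 1) => ((Fin.snoc π ρ : Fin (T + 1) → P) k,
          (Fin.snoc w x : Fin (T + 1) → W) k)) =
        Fin.snoc (α := fun _ => P × W) (fun k => (π k, w k)) (ρ, x) := by
      intro π ρ w x
      funext k
      refine Fin.lastCases ?_ (fun k => ?_) k <;> simp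
    have hstep : ∀ (w : Fin T → W) (x : W), ∑ π : Fin (T + 1) → P,
        (∏ t : Fin (T + 1), K t (past (fun k => (π k, (Fin.snoc w x : Fin (T + 1) → W) k)) t)
          (π t)) * ∏ t, e (π t) ((Fin.snoc w x : Fin (T + 1) → W) t) =
        ∑ π : Fin T → P, ∑ ρ, ((∏ t : Fin T, K t (past (fun k => (π k, w k)) t) (π t)) *
          ∏ t, e (π t) (w t)) * (K T (fun k => (π k, w k)) ρ * e ρ x) := by
      intro w x
      rw [sum_fin_succ_pi]
      refine Finset.sum_congr rfl fun π _ => Finset.sum_congr rfl fun ρ _ => ?_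
      have hs := prod_past_snoc (fun t (h : Fin t → P × W) y => K t h y.1 * e y.1 y.2)
        (fun k => (π k, w k)) (ρ, x)
      rw [← hpair] at hs
      rw [← Finset.prod_mul_distrib, ← Finset.prod_mul_distrib]
      rw [← hs]
    rw [integral_pi_fin_succ μ (hint (T + 1)), pow_succ]
    refine le_trans ?_ (mul_le_mul_of_nonneg_right ih hC0)
    rw [← integral_mul_const]
    -- The last action is drawn before the last signal, so for a fixed action the signal integrates
    -- out to the mean of `e ρ`.
    have hinner : ∀ w : Fin T → W, ∫ x, ∑ π : Fin (T + 1) → P,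
        (∏ t : Fin (T + 1), K t (past (fun k => (π k, (Fin.snoc w x : Fin (T + 1) → W) k)) t)
          (π t)) * ∏ t, e (π t) ((Fin.snoc w x : Fin (T + 1) → W) t) ∂μ =
        ∑ π : Fin T → P, ((∏ t : Fin T, K t (past (fun k => (π k, w k)) t) (π t)) *
          ∏ t, e (π t) (w t)) * ∑ ρ, K T (fun k => (π k, w k)) ρ * ∫ x, e ρ x ∂μ := by
      intro w
      simp_rw [hstep]
      rw [integral_finsetSum _ fun π _ => integrable_finsetSum _ fun ρ _ =>
        ((heint ρ).const_mul _).const_mul _]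
      refine Finset.sum_congr rfl fun π _ => ?_
      rw [integral_finsetSum _ fun ρ _ => ((heint ρ).const_mul _).const_mul _, Finset.mul_sum]
      refine Finset.sum_congr rfl fun ρ _ => ?_
      rw [integral_const_mul, integral_const_mul]
    simp_rw [hinner]
    refine integral_mono ?_ ((hint T).mul_const C) fun w => ?_
    · refine integrable_finsetSum _ fun π _ => ?_
      simp_rw [Finset.mul_sum]
      refine integrable_finsetSum _ fun ρ _ => ?_
      have hb := (hK.integrable_prod_mul (μ := μ) π he he0 hC₀).bdd_mul (c := 1)
        (hK.measurable T π ρ).aestronglyMeasurable (Filter.Eventually.of_forall fun w => by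
          rw [Real.norm_of_nonneg (hK.nonneg _ _ _)]; exact hK.le_one _ _ _)
      refine (hb.mul_const (∫ x, e ρ x ∂μ)).congr (Filter.Eventually.of_forall fun w => ?_)
      simp only
      ring
    · simp only
      rw [Finset.sum_mul]
      refine Finset.sum_le_sum fun π _ => mul_le_mul_of_nonneg_left ?_
        (mul_nonneg (hK.prod_nonneg π w) (Finset.prod_nonneg fun _ _ => he0 _ _))
      calc ∑ ρ, K T (fun k => (π k, w k)) ρ * ∫ x, e ρ x ∂μ
          ≤ ∑ ρ, K T (fun k => (π k, w k)) ρ * C :=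
            Finset.sum_le_sum fun ρ _ => mul_le_mul_of_nonneg_left (hC ρ) (hK.nonneg _ _ _)
        _ = C := by rw [← Finset.sum_mul, hK.sum_eq_one, one_mul]

end IsActionKernel

/-! ### Hoeffding's lemma, the soft maximum and swap regret. -/

/-- Hoeffding's lemma for the deviation from the mean of a random variable with values in
`[-1, 1]`. -/
theorem integral_exp_mul_mean_sub_le {W : Type*} [MeasurableSpace W] (μ : Measure W)
    [IsProbabilityMeasure μ] {Y : W → ℝ} (hY : Measurable Y) (hb : ∀ w, Y w ∈ Set.Icc (-1 : ℝ) 1)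
    (l : ℝ) : ∫ w, Real.exp (l * ((∫ x, Y x ∂μ) - Y w)) ∂μ ≤ Real.exp (l ^ 2 / 2) := by
  have h := (hasSubgaussianMGF_of_mem_Icc (μ := μ) hY.aemeasurable
    (Filter.Eventually.of_forall hb)).mgf_le (-l)
  -- The variance proxy is the squared half-length of `[-1, 1]`.
  have hc : (((‖(1 : ℝ) - -1‖₊ / 2) ^ 2 : NNReal) : ℝ) = 1 := by
    norm_num
  rw [hc, mgf] at h
  refine le_trans (le_of_eq (integral_congr_ae (Filter.Eventually.of_forall fun w => ?_)))
    (h.trans (le_of_eq ?_))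
  · simp only
    congr 1
    ring
  · congr 1
    ring

theorem sum_empirical_mul {M N T : ℕ} {Ψ : Fin M → Type*} [∀ i, Fintype (Ψ i)]
    [∀ i, DecidableEq (Ψ i)] (π : Fin T → PolicyProfile N Ψ) (F : PolicyProfile N Ψ → ℝ) :
    ∑ ρ, empirical π ρ * F ρ = (∑ t, F (π t)) / T := by
  simp_rw [empirical, Finset.card_filter, Nat.cast_sum, div_mul_eq_mul_div, Finset.sum_mul]
  rw [← Finset.sum_div, Finset.sum_comm]
  simp

/-- The soft maximum bounds each of its terms. -/
theorem le_add_sum_exp {ι : Type*} [Fintype ι] (x : ι → ℝ) (j : ι) {l c : ℝ} (hl : 0 < l) :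
    x j ≤ c - 1 / l + Real.exp (-(l * c)) / l * ∑ k, Real.exp (l * x k) := by
  -- The tangent inequality replaces the logarithm of the usual soft maximum, so the bound is linear
  -- in the exponentials and can be integrated directly.
  have h1 : l * (x j - c) ≤ Real.exp (l * (x j - c)) - 1 := by
    linarith [Real.add_one_le_exp (l * (x j - c))]
  have h2 : Real.exp (l * (x j - c)) ≤ Real.exp (-(l * c)) * ∑ k, Real.exp (l * x k) := by
    rw [show l * (x j - c) = -(l * c) + l * x j by ring, Real.exp_add]
    exact mul_le_mul_of_nonneg_left (Finset.single_le_sum (f := fun k => Real.exp (l * x k))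
      (fun k _ => (Real.exp_pos _).le) (Finset.mem_univ j)) (Real.exp_pos _).le
  have h3 : x j - c ≤ (Real.exp (-(l * c)) * ∑ k, Real.exp (l * x k) - 1) / l := by
    rw [le_div_iff₀ hl]
    linarith
  calc x j ≤ c + (Real.exp (-(l * c)) * ∑ k, Real.exp (l * x k) - 1) / l := by linarith
    _ = _ := by ring

theorem sum_sub_sum_le_swapRegret {N T : ℕ} (a : Fin T → Fin N) (b : Fin T → Fin N → ℝ)
    (g : Fin N → Fin N) : ∑ t, (b t (g (a t)) - b t (a t)) ≤ swapRegret a b := by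
  rw [Finset.sum_sub_distrib]
  exact sub_le_sub_right (le_ciSup (f := fun f : Fin N → Fin N => ∑ t, b t (f (a t)))
    (Set.finite_range _).bddAbove g) _

theorem card_le_maxSignals {M : ℕ} {Ψ : Fin M → Type*} [∀ i, Fintype (Ψ i)] (i : Fin M) :
    Fintype.card (Ψ i) ≤ maxSignals Ψ :=
  Finset.le_sup (f := fun i => Fintype.card (Ψ i)) (Finset.mem_univ i)

/-! ### Regret of the parallel bandit algorithm. -/

namespace BayesianGame

variable {M N : ℕ} {Ψ : Fin M → Type*} {X Θ : Type*} [MeasurableSpace X] [MeasurableSpace Θ]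
  (G : BayesianGame M N Ψ X Θ)

theorem nonempty_states (G : BayesianGame M N Ψ X Θ) : Nonempty (X × Θ) :=
  nonempty_of_isProbabilityMeasure G.law

theorem integrable_payoff [∀ i, Fintype (Ψ i)] (i : Fin M) (π : PolicyProfile N Ψ) :
    Integrable (G.payoff i π) G.law :=
  Integrable.of_mem_Icc 0 1 (G.measurable_payoff i π).aemeasurable
    (Filter.Eventually.of_forall (G.payoff_mem i π))

theorem expectedPayoff_mem [∀ i, Fintype (Ψ i)] (i : Fin M)
    (π : PolicyProfile N Ψ) :
    G.expectedPayoff i π ∈ Set.Icc (0 : ℝ) 1 := by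
  refine ⟨integral_nonneg fun w => (G.payoff_mem i π w).1, ?_⟩
  have h := integral_mono (G.integrable_payoff i π) (integrable_const (1 : ℝ))
    fun w => (G.payoff_mem i π w).2
  simpa [expectedPayoff] using h

variable [∀ i, DecidableEq (Ψ i)]

/-- The gain of player `i` in one round from the swap function `g` on the signal `s`. -/
def swapGain (i : Fin M) (s : Ψ i) (g : Fin N → Fin N) (π : PolicyProfile N Ψ) (w : X × Θ) : ℝ :=
  G.copyReward i s π w (g (π i s)) - G.copyReward i s π w (π i s)

theorem swapGain_mem (i : Fin M) (s : Ψ i) (g : Fin N → Fin N) (π : PolicyProfile N Ψ)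
    (w : X × Θ) : G.swapGain i s g π w ∈ Set.Icc (-1 : ℝ) 1 := by
  have h1 := G.recordedReward_mem i s (setAction i s (g (π i s)) π) w
  have h2 := G.recordedReward_mem i s (setAction i s (π i s) π) w
  unfold swapGain copyReward
  constructor <;> linarith [h1.1, h1.2, h2.1, h2.2]

variable [∀ i, Fintype (Ψ i)]

/-- The probability that the policy profile `ρ` is used after the past `h`. -/
def stepProb (B : BanditAlgorithm N) (t : ℕ) (h : Fin t → PolicyProfile N Ψ × (X × Θ))
    (ρ : PolicyProfile N Ψ) : ℝ :=
  ∏ c : Σ i, Ψ i, B.prob t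
    (fun k => ((h k).1 c.1 c.2, G.recordedReward c.1 c.2 (h k).1 (h k).2)) (ρ c.1 c.2)

theorem isActionKernel_stepProb (B : BanditAlgorithm N) : IsActionKernel (G.stepProb B) where
  nonneg t h ρ := Finset.prod_nonneg fun _ _ => B.prob_nonneg _ _ _
  sum_eq_one t h := by
    rw [← sum_prod_prob_eq_one (fun (c : Σ i, Ψ i) => B.prob t
      (fun k => ((h k).1 c.1 c.2, G.recordedReward c.1 c.2 (h k).1 (h k).2)))
      fun c => B.prob_sum t _]
    exact Fintype.sum_equiv (Equiv.piCurry fun (i : Fin M) (_ : Ψ i) => Fin N).symm _ _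
      fun ρ => rfl
  measurable t π ρ := Finset.measurable_fun_prod _ fun c _ =>
    (B.measurable_prob t _).comp (measurable_pi_lambda _ fun k =>
      measurable_const.prodMk ((G.measurable_recordedReward c.1 c.2 (π k)).comp
        (measurable_pi_apply k)))

theorem playProb_eq_prod_stepProb (B : BanditAlgorithm N) {T : ℕ} (w : Fin T → X × Θ)
    (π : Fin T → PolicyProfile N Ψ) :
    G.playProb B w π = ∏ t : Fin T, G.stepProb B t (past (fun k => (π k, w k)) t) (π t) :=
  G.playProb_eq_prod B w π

theorem playProb_nonneg (B : BanditAlgorithm N) {T : ℕ} (w : Fin T → X × Θ)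
    (π : Fin T → PolicyProfile N Ψ) : 0 ≤ G.playProb B w π := by
  rw [playProb_eq_prod_stepProb]
  exact (G.isActionKernel_stepProb B).prod_nonneg π w

theorem sum_playProb (B : BanditAlgorithm N) {T : ℕ} (w : Fin T → X × Θ) :
    ∑ π, G.playProb B w π = 1 := by
  have := G.nonempty_states
  simp_rw [playProb_eq_prod_stepProb]
  exact (G.isActionKernel_stepProb B).sum_prod_eq_one w

theorem integrable_playProb (B : BanditAlgorithm N) {T : ℕ} (π : Fin T → PolicyProfile N Ψ) :
    Integrable (fun w => G.playProb B w π) (Measure.pi fun _ : Fin T => G.law) := by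
  simp_rw [playProb_eq_prod_stepProb]
  exact Integrable.of_mem_Icc 0 1 ((G.isActionKernel_stepProb B).measurable_prod π).aemeasurable
    (Filter.Eventually.of_forall fun w => ⟨(G.isActionKernel_stepProb B).prod_nonneg π w,
      (G.isActionKernel_stepProb B).prod_le_one π w⟩)

/-- There are finitely many policy sequences, so the expectation is a finite weighted sum;
monotonicity and linearity need no integrability of `F`. -/
theorem playExpectation_eq_sum (B : BanditAlgorithm N) {T : ℕ}
    (F : (Fin T → PolicyProfile N Ψ) → ℝ) :
    G.playExpectation B T F =
      ∑ π, (∫ w, G.playProb B w π ∂(Measure.pi fun _ : Fin T => G.law)) * F π := by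
  unfold playExpectation
  rw [integral_finsetSum _ fun π _ => (G.integrable_playProb B π).mul_const _]
  simp_rw [integral_mul_const]

theorem playExpectation_mono (B : BanditAlgorithm N) {T : ℕ}
    {F F' : (Fin T → PolicyProfile N Ψ) → ℝ} (h : ∀ π, F π ≤ F' π) :
    G.playExpectation B T F ≤ G.playExpectation B T F' := by
  rw [playExpectation_eq_sum, playExpectation_eq_sum]
  exact Finset.sum_le_sum fun π _ => mul_le_mul_of_nonneg_left (h π)
    (integral_nonneg fun w => G.playProb_nonneg B w π)

theorem playExpectation_const (B : BanditAlgorithm N) {T : ℕ} (c : ℝ) :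
    G.playExpectation B T (fun _ => c) = c := by
  unfold playExpectation
  simp_rw [← Finset.sum_mul, sum_playProb]
  simp

theorem sum_playExpectation_mul {κ : Type*} [Fintype κ] (B : BanditAlgorithm N) {T : ℕ}
    (F : κ → (Fin T → PolicyProfile N Ψ) → ℝ) (v : κ → ℝ) :
    ∑ k, G.playExpectation B T (F k) * v k =
      G.playExpectation B T (fun π => ∑ k, F k π * v k) := by
  simp_rw [playExpectation_eq_sum, Finset.sum_mul, Finset.mul_sum]
  rw [Finset.sum_comm]
  simp_rw [mul_assoc]

theorem measurable_swapGain (i : Fin M) (s : Ψ i) (g : Fin N → Fin N) (π : PolicyProfile N Ψ) :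
    Measurable (G.swapGain i s g π) :=
  (G.measurable_recordedReward _ _ _).sub (G.measurable_recordedReward _ _ _)

theorem integrable_swapGain (i : Fin M) (s : Ψ i) (g : Fin N → Fin N) (π : PolicyProfile N Ψ) :
    Integrable (G.swapGain i s g π) G.law :=
  Integrable.of_mem_Icc (-1) 1 (G.measurable_swapGain i s g π).aemeasurable
    (Filter.Eventually.of_forall (G.swapGain_mem i s g π))

/-- The mean of `swapGain` over the states and reward tensors. -/
noncomputable def meanSwapGain (i : Fin M) (s : Ψ i) (g : Fin N → Fin N) (π : PolicyProfile N Ψ) : ℝ :=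
  ∫ w, G.swapGain i s g π w ∂G.law

theorem meanSwapGain_le_one (i : Fin M) (s : Ψ i) (g : Fin N → Fin N) (π : PolicyProfile N Ψ) :
    G.meanSwapGain i s g π ≤ 1 := by
  have h := integral_mono (G.integrable_swapGain i s g π) (integrable_const (1 : ℝ))
    fun w => (G.swapGain_mem i s g π w).2
  simpa [meanSwapGain] using h

/-- Only the observed signal contributes to a payoff, and there the deviation changes just the one
action `π i s`. Hence the swaps on different signals decouple. -/
theorem expectedPayoff_deviate_sub (i : Fin M) (f : Fin N → Ψ i → Fin N) (π : PolicyProfile N Ψ) :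
    G.expectedPayoff i (deviate i f π) - G.expectedPayoff i π =
      ∑ s, G.meanSwapGain i s (fun a => f a s) π := by
  unfold expectedPayoff meanSwapGain
  rw [← integral_sub (G.integrable_payoff _ _) (G.integrable_payoff _ _),
    ← integral_finsetSum _ fun s _ => G.integrable_swapGain _ _ _ _]
  refine integral_congr_ae (Filter.Eventually.of_forall fun w => ?_)
  simp only
  rw [← sum_recordedReward, ← sum_recordedReward, ← Finset.sum_sub_distrib]
  refine Finset.sum_congr rfl fun s _ => ?_
  unfold swapGain
  rw [G.copyReward_eq (π' := deviate i f π) (by simp [deviate])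
    (fun j hj => by simp [deviate, hj]), G.copyReward_eq (π' := π) rfl fun j _ => rfl]

theorem deviationValue_sub_followValue (D : PolicyProfile N Ψ → ℝ) (i : Fin M)
    (f : Fin N → Ψ i → Fin N) :
    G.deviationValue D i f - G.followValue D i =
      ∑ ρ, D ρ * (G.expectedPayoff i (deviate i f ρ) - G.expectedPayoff i ρ) := by
  unfold deviationValue followValue
  simp_rw [mul_sub]
  rw [Finset.sum_sub_distrib]

theorem deviationValue_sub_le_averageRegret (D : PolicyProfile N Ψ → ℝ) (i : Fin M)
    (f : Fin N → Ψ i → Fin N) :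
    G.deviationValue D i f - G.followValue D i ≤ G.averageRegret D i :=
  le_ciSup (f := fun f => G.deviationValue D i f - G.followValue D i)
    (Set.finite_range _).bddAbove f

theorem averageRegret_empirical_le_one [Nonempty (Fin N)] {T : ℕ} (hT : 0 < T)
    (π : Fin T → PolicyProfile N Ψ) (i : Fin M) : G.averageRegret (empirical π) i ≤ 1 := by
  refine ciSup_le fun f => ?_
  rw [deviationValue_sub_followValue, sum_empirical_mul, div_le_one (by exact_mod_cast hT)]
  calc ∑ t, (G.expectedPayoff i (deviate i f (π t)) - G.expectedPayoff i (π t))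
      ≤ ∑ _t : Fin T, (1 : ℝ) := Finset.sum_le_sum fun t _ => by
        linarith [(G.expectedPayoff_mem i (deviate i f (π t))).2, (G.expectedPayoff_mem i (π t)).1]
    _ = T := by simp

/-- The average regret is at most the sum over the signals of the average swap regret of the copy
and a soft maximum of the deviation of the realised gains from their means. -/
theorem averageRegret_empirical_le [Nonempty (Fin N)] {T : ℕ} (π : Fin T → PolicyProfile N Ψ)
    (w : Fin T → X × Θ) (i : Fin M) {l : ℝ} (c : ℝ) (hl : 0 < l) :
    G.averageRegret (empirical π) i ≤
      ∑ s, (swapRegret (fun t => π t i s) (fun t => G.copyReward i s (π t) (w t)) / T +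
        (c - 1 / l + Real.exp (-(l * c)) / l * ∑ g : Fin N → Fin N,
          ∏ t, Real.exp (l * (G.meanSwapGain i s g (π t) - G.swapGain i s g (π t) (w t)))) / T) := by
  refine ciSup_le fun f => ?_
  rw [deviationValue_sub_followValue, sum_empirical_mul]
  simp_rw [expectedPayoff_deviate_sub]
  rw [Finset.sum_comm, Finset.sum_div]
  refine Finset.sum_le_sum fun s _ => ?_
  rw [← add_div]
  refine div_le_div_of_nonneg_right ?_ (Nat.cast_nonneg T)
  have h1 := sum_sub_sum_le_swapRegret (fun t => π t i s)
    (fun t => G.copyReward i s (π t) (w t)) fun a => f a s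
  -- The sum runs over all swap functions because the best `f` may depend on the play.
  have h2 := le_add_sum_exp (c := c) (fun g : Fin N → Fin N =>
    ∑ t, (G.meanSwapGain i s g (π t) - G.swapGain i s g (π t) (w t))) (fun a => f a s) hl
  simp_rw [Finset.mul_sum (s := (Finset.univ : Finset (Fin T))), Real.exp_sum] at h2
  rw [Finset.sum_sub_distrib] at h2
  have h3 : ∑ t, G.swapGain i s (fun a => f a s) (π t) (w t) ≤
      swapRegret (fun t => π t i s) (fun t => G.copyReward i s (π t) (w t)) := h1
  linarith

theorem integrable_sum_playProb_mul_exp (B : BanditAlgorithm N) (T : ℕ) (i : Fin M) (s : Ψ i)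
    (g : Fin N → Fin N) {l : ℝ} (hl : 0 ≤ l) :
    Integrable (fun w => ∑ π : Fin T → PolicyProfile N Ψ, G.playProb B w π *
      ∏ t, Real.exp (l * (G.meanSwapGain i s g (π t) - G.swapGain i s g (π t) (w t))))
      (Measure.pi fun _ => G.law) ∧
    ∫ w, ∑ π : Fin T → PolicyProfile N Ψ, G.playProb B w π *
      ∏ t, Real.exp (l * (G.meanSwapGain i s g (π t) - G.swapGain i s g (π t) (w t)))
      ∂(Measure.pi fun _ => G.law) ≤ Real.exp (l ^ 2 / 2) ^ T := by
  have hm : ∀ ρ, Measurable fun w =>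
      Real.exp (l * (G.meanSwapGain i s g ρ - G.swapGain i s g ρ w)) := fun ρ =>
    ((measurable_const.sub (G.measurable_swapGain i s g ρ)).const_mul l).exp
  have h0 : ∀ ρ w, 0 ≤ Real.exp (l * (G.meanSwapGain i s g ρ - G.swapGain i s g ρ w)) :=
    fun ρ w => (Real.exp_pos _).le
  -- The mean gain is at most `1` and the realised gain at least `-1`, hence the factor `2`; the
  -- bound serves only integrability.
  have hb : ∀ ρ w, Real.exp (l * (G.meanSwapGain i s g ρ - G.swapGain i s g ρ w)) ≤
      Real.exp (l * 2) := fun ρ w => Real.exp_le_exp.2 (mul_le_mul_of_nonneg_left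
    (by linarith [G.meanSwapGain_le_one i s g ρ, (G.swapGain_mem i s g ρ w).1]) hl)
  simp_rw [playProb_eq_prod_stepProb]
  exact ⟨integrable_finsetSum _ fun π _ =>
    (G.isActionKernel_stepProb B).integrable_prod_mul π hm h0 hb,
    (G.isActionKernel_stepProb B).integral_sum_prod_mul_le G.law T hm h0 hb (Real.exp_pos _).le
      fun ρ => integral_exp_mul_mean_sub_le G.law (G.measurable_swapGain i s g ρ)
        (G.swapGain_mem i s g ρ) l⟩

/-- The average regret of the parallel bandit algorithm, in terms of the swap regret of a single
copy and of a parameter `l` of the exponential moments. -/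
theorem playExpectation_averageRegret_le (B : BanditAlgorithm N) {T : ℕ} {δ l c : ℝ} (hl : 0 < l)
    (hB : ∀ Adv : AdaptiveAdversary N, expectedAverageSwapRegret B Adv T ≤ δ)
    (hc : N * Real.log N + T * (l ^ 2 / 2) ≤ l * c) (i : Fin M) :
    G.playExpectation B T (fun π => G.averageRegret (empirical π) i) ≤
      Fintype.card (Ψ i) * (δ + c / T) := by
  have : Nonempty (Fin N) := ⟨⟨0, B.pos⟩⟩
  have := G.nonempty_states
  let E : (s : Ψ i) → (Fin N → Fin N) → (Fin T → X × Θ) → ℝ := fun s g w =>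
    ∑ π : Fin T → PolicyProfile N Ψ, G.playProb B w π *
      ∏ t, Real.exp (l * (G.meanSwapGain i s g (π t) - G.swapGain i s g (π t) (w t)))
  have hE := fun s g => G.integrable_sum_playProb_mul_exp B T i s g hl.le
  have hpt : ∀ w : Fin T → X × Θ,
      ∑ π, G.playProb B w π * G.averageRegret (empirical π) i ≤
        ∑ s, (δ + (c - 1 / l + Real.exp (-(l * c)) / l * ∑ g, E s g w) / T) := by
    intro w
    have hreg : ∀ s, ∑ π : Fin T → PolicyProfile N Ψ, G.playProb B w π *
        (swapRegret (fun t => π t i s) (fun t => G.copyReward i s (π t) (w t)) / T) ≤ δ := by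
      intro s
      let v : ℕ → X × Θ := fun k => if h : k < T then w ⟨k, h⟩ else Classical.arbitrary _
      have hv : w = fun t : Fin T => v t := by
        funext t; simp [v]
      rw [hv]
      exact G.sum_playProb_mul_swapRegret_le B hB v i s
    refine (Finset.sum_le_sum fun π _ => mul_le_mul_of_nonneg_left
      (G.averageRegret_empirical_le π w i c hl) (G.playProb_nonneg B w π)).trans ?_
    simp_rw [Finset.mul_sum (s := (Finset.univ : Finset (Ψ i)))]
    rw [Finset.sum_comm]
    refine Finset.sum_le_sum fun s _ => ?_
    simp_rw [mul_add]
    rw [Finset.sum_add_distrib]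
    refine add_le_add (hreg s) (le_of_eq ?_)
    simp_rw [← mul_div_assoc]
    rw [← Finset.sum_div]
    congr 1
    simp_rw [mul_add]
    rw [Finset.sum_add_distrib, ← Finset.sum_mul, sum_playProb, one_mul]
    congr 1
    simp_rw [E, Finset.mul_sum]
    rw [Finset.sum_comm]
    exact Finset.sum_congr rfl fun g _ => Finset.sum_congr rfl fun π _ => by ring
  have hint : ∀ s, Integrable
      (fun w => δ + (c - 1 / l + Real.exp (-(l * c)) / l * ∑ g, E s g w) / T)
      (Measure.pi fun _ => G.law) := fun s =>
    (integrable_const _).add (((integrable_const _).add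
      ((integrable_finsetSum _ fun g _ => (hE s g).1).const_mul _)).div_const _)
  unfold playExpectation
  refine (integral_mono (integrable_finsetSum _ fun π _ => (G.integrable_playProb B π).mul_const _)
    (integrable_finsetSum _ fun s _ => hint s) hpt).trans ?_
  rw [integral_finsetSum _ fun s _ => hint s]
  have hs : ∀ s, ∫ w, (δ + (c - 1 / l + Real.exp (-(l * c)) / l * ∑ g, E s g w) / T)
      ∂(Measure.pi fun _ => G.law) ≤ δ + c / T := by
    intro s
    have hsum : Integrable (fun w => Real.exp (-(l * c)) / l * ∑ g, E s g w)
        (Measure.pi fun _ => G.law) :=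
      (integrable_finsetSum _ fun g _ => (hE s g).1).const_mul _
    have hadd : Integrable (fun w => (c - 1 / l + Real.exp (-(l * c)) / l * ∑ g, E s g w) / T)
        (Measure.pi fun _ => G.law) := ((integrable_const _).add hsum).div_const _
    rw [integral_add (integrable_const _) hadd,
      integral_div, integral_add (integrable_const _) hsum, integral_const_mul,
      integral_finsetSum _ fun g _ => (hE s g).1]
    simp only [integral_const, probReal_univ, one_smul]
    refine add_le_add le_rfl (div_le_div_of_nonneg_right ?_ (Nat.cast_nonneg T))
    have hN : (0 : ℝ) < N := by exact_mod_cast B.pos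
    have hcard : ∑ g, ∫ w, E s g w ∂(Measure.pi fun _ => G.law) ≤ Real.exp (l * c) := by
      refine (Finset.sum_le_sum fun g _ => (hE s g).2).trans ?_
      rw [Finset.sum_const, nsmul_eq_mul, ← Real.exp_nat_mul]
      -- The union over the `N ^ N` swap functions is the source of `N log N`.
      have hNN : (((Finset.univ : Finset (Fin N → Fin N)).card : ℕ) : ℝ) =
          Real.exp (N * Real.log N) := by
        rw [Real.exp_nat_mul, Real.exp_log hN]
        simp
      rw [hNN, ← Real.exp_add]
      exact Real.exp_le_exp.2 hc
    -- The exponential term is at most `1 / l`, which the `-1 / l` of the soft maximum cancels,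
    -- leaving `c`.
    have hmul := mul_le_mul_of_nonneg_left hcard
      (div_nonneg (Real.exp_pos (-(l * c))).le hl.le)
    rw [div_mul_eq_mul_div _ _ (Real.exp (l * c)), ← Real.exp_add, neg_add_cancel,
      Real.exp_zero] at hmul
    linarith
  refine (Finset.sum_le_sum fun s _ => hs s).trans (le_of_eq ?_)
  rw [Finset.sum_const, nsmul_eq_mul, Finset.card_univ]

theorem playExpectation_averageRegret_le_of_extendedRuntime_le (B : ℕ → BanditAlgorithm N)
    {ε : ℝ} (hε : 0 < ε) {T : ℕ} (hT : 0 < T)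
    (hB : extendedRuntime B (ε / (4 * (maxSignals Ψ : ℝ))) ≤ (T : ℕ∞)) (i : Fin M) :
    G.playExpectation (B T) T (fun π => G.averageRegret (empirical π) i) ≤ ε := by
  have : Nonempty (Fin N) := ⟨⟨0, (B T).pos⟩⟩
  -- Regret never exceeds `1`, so only `ε < 1` needs the runtime; there `δ ≤ 2`, and the logarithmic
  -- summand of the runtime is nonnegative and can be dropped.
  rcases le_or_gt 1 ε with h1 | h1
  · refine le_trans ?_ h1
    rw [← G.playExpectation_const (B T) (T := T) 1]
    exact G.playExpectation_mono (B T) fun π => G.averageRegret_empirical_le_one hT π i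
  · have hcard : 0 < Fintype.card (Ψ i) :=
      Fintype.card_pos_iff.2 (G.nonempty_states.map fun w => G.signal i w.1)
    have hS : (Fintype.card (Ψ i) : ℝ) ≤ maxSignals Ψ := by
      exact_mod_cast card_le_maxSignals i
    have hS1 : (1 : ℝ) ≤ maxSignals Ψ := by
      exact_mod_cast hcard.trans_le (card_le_maxSignals i)
    have hT' : (0 : ℝ) < T := by exact_mod_cast hT
    set δ := ε / (4 * (maxSignals Ψ : ℝ)) with hδ
    have hδ0 : 0 < δ := by positivity
    have hδS : δ * maxSignals Ψ = ε / 4 := by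
      rw [hδ]; field_simp
    have hδ1 : δ ≤ 2 := by nlinarith
    have hlog : 0 ≤ Real.log (2 / δ) := Real.log_nonneg ((one_le_div hδ0).2 hδ1)
    have hceil : 2 * (N * Real.log N + Real.log (2 / δ)) / δ ^ 2 ≤ T :=
      (Nat.le_ceil _).trans (by
        exact_mod_cast ENat.natCast_le_natCast.1 ((le_max_right _ _).trans hB))
    rw [div_le_iff₀ (by positivity)] at hceil
    -- For `l = δ` and `c = T * δ` the condition reads `N log N ≤ T * δ ^ 2 / 2`, which `hceil`
    -- provides.
    have hmain := G.playExpectation_averageRegret_le (B T) (c := T * δ) hδ0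
      (fun Adv => expectedAverageSwapRegret_le_of_runtime_le ((le_max_left _ _).trans hB) Adv)
      (by nlinarith) i
    refine hmain.trans ?_
    rw [mul_div_cancel_left₀ δ hT'.ne']
    nlinarith

end BayesianGame

/-! ### The equilibrium property of the expected empirical distribution. -/

theorem empirical_nonneg {M N T : ℕ} {Ψ : Fin M → Type*} [∀ i, Fintype (Ψ i)]
    [∀ i, DecidableEq (Ψ i)] (π : Fin T → PolicyProfile N Ψ) (ρ : PolicyProfile N Ψ) :
    0 ≤ empirical π ρ := by
  unfold empirical
  positivity

theorem sum_empirical {M N T : ℕ} {Ψ : Fin M → Type*} [∀ i, Fintype (Ψ i)]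
    [∀ i, DecidableEq (Ψ i)] (hT : 0 < T) (π : Fin T → PolicyProfile N Ψ) :
    ∑ ρ, empirical π ρ = 1 := by
  have h := sum_empirical_mul π fun _ => 1
  have hT' : (T : ℝ) ≠ 0 := by exact_mod_cast hT.ne'
  simpa [hT'] using h

theorem mainTheorem10 {M N : ℕ} {Ψ : Fin M → Type*} [∀ i, Fintype (Ψ i)] [∀ i, DecidableEq (Ψ i)]
    {X Θ : Type*} [MeasurableSpace X] [MeasurableSpace Θ]
    (G : BayesianGame M N Ψ X Θ) (B : ℕ → BanditAlgorithm N)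
    (ε : ℝ) (hε : 0 < ε) (T : ℕ) (hT : 0 < T)
    (hB : extendedRuntime B (ε / (4 * (maxSignals Ψ : ℝ))) ≤ (T : ℕ∞)) :
    (∀ i : Fin M, G.playExpectation (B T) T (fun π => G.averageRegret (empirical π) i) ≤ ε) ∧
    G.IsApproxBCE ε (fun ρ => G.playExpectation (B T) T (fun π => empirical π ρ)) := by
  have hreg := G.playExpectation_averageRegret_le_of_extendedRuntime_le B hε hT hB
  refine ⟨hreg, ⟨fun ρ => ?_, ?_⟩, fun i f => ?_⟩
  · rw [← G.playExpectation_const (B T) (T := T) 0]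
    exact G.playExpectation_mono (B T) fun π => empirical_nonneg π ρ
  · have h := G.sum_playExpectation_mul (B T) (fun ρ (π : Fin T → PolicyProfile N Ψ) =>
      empirical π ρ) fun _ => 1
    simp only [mul_one, sum_empirical hT] at h
    rw [h, G.playExpectation_const]
  · have h : G.deviationValue (fun ρ => G.playExpectation (B T) T (fun π => empirical π ρ)) i f -
        G.followValue (fun ρ => G.playExpectation (B T) T (fun π => empirical π ρ)) i ≤ ε := by
      -- The gain from a fixed `f` is linear in the distribution, so it is the expected gain against
      -- the empirical distribution, and the maximum inside the expectation dominates it.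
      rw [G.deviationValue_sub_followValue, G.sum_playExpectation_mul]
      refine (G.playExpectation_mono (B T) fun π => ?_).trans (hreg i)
      rw [← G.deviationValue_sub_followValue]
      exact G.deviationValue_sub_le_averageRegret (empirical π) i f
    linarith
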